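/- Let $n\ge 2$, and identify $\mathbb C^n$ with $\mathbb R^{2n}$ with its Euclidean distance $d$ and Lebesgue measure. Let $\Omega\subset\mathbb C^n$ be a domain (a non-empty connected open set) and $E\subset\mathbb C^n$ a closed set such that 1. there exists $r>0$ such that $E_r:=\{z\in\mathbb C^n: d(z,E)\le r\}\subset\Omega$; 2. there exist a (non-empty) real affine subspace $H\subset\mathbb R^{2n}=\mathbb C^n$ of real codimension $\ge 3$ and a number $R>0$ such that $E\subset H_R:=\{z\in\mathbb C^n: d(z,H)<R\}$; 3. $\Omega\setminus E$ is connected. (Here $d(z,\emptyset)=\infty$.) For an open set $U\subset\mathbb C^n$ let $A^2(U)$ be the Bergman space of all holomorphic functions $f$ on $U$ with $\int_U|f|^2<\infty$. Then every $f\in A^2(\Omega\setminus E)$ extends to a function $F\in A^2(\Omega)$, i.e. $F=f$ on $\Omega\setminus E$. In other words, $A^2(\Omega\setminus E)$ coincides with $A^2(\Omega)$: the restriction map $F\mapsto F|_{\Omega\setminus E}$ is a bijection from $A^2(\Omega)$ onto $A^2(\Omega\setminus E)$. -/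

import Mathlib

open MeasureTheory

/-- `ℂⁿ` with its Hermitian norm; the distance is the Euclidean distance of `ℝ²ⁿ = ℂⁿ`, and `volume`
is Lebesgue measure. -/
abbrev CSpace (n : ℕ) : Type := EuclideanSpace ℂ (Fin n)

/-- `F` is an `L²` holomorphic function on the open set `U`: it is complex differentiable at the
points of `U` and `∫_U |F|² < ∞`. The values of `F` outside `U` play no role. -/
def IsL2Holomorphic {n : ℕ} (U : Set (CSpace n)) (F : CSpace n → ℂ) : Prop :=
  DifferentiableOn ℂ F U ∧ MemLp F 2 (volume.restrict U)

/-- The Bergman space `A²(U)` of an open set `U ⊆ ℂⁿ`: the complex vector space of all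
functions `f : U → ℂ` that are holomorphic and square integrable on `U`. -/
def bergmanSpace {n : ℕ} (U : Set (CSpace n)) : Submodule ℂ (U → ℂ) where
  carrier := {f | ∃ F : CSpace n → ℂ, IsL2Holomorphic U F ∧ (fun z : U => F z) = f}
  add_mem' := by
    rintro _ _ ⟨F, hF, rfl⟩ ⟨G, hG, rfl⟩
    exact ⟨F + G, ⟨hF.1.add hG.1, hF.2.add hG.2⟩, rfl⟩
  zero_mem' := ⟨0, ⟨differentiableOn_const 0, MemLp.zero⟩, rfl⟩
  smul_mem' := by
    rintro c _ ⟨F, hF, rfl⟩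
    exact ⟨c • F, ⟨hF.1.const_smul c, hF.2.const_smul c⟩, rfl⟩

/-- The restriction of a function on `Ω` to `Ω \ E`. -/
def restrictToDiff {n : ℕ} (Ω E : Set (CSpace n)) (f : Ω → ℂ) : (Ω \ E : Set (CSpace n)) → ℂ :=
  fun z => f ⟨z.1, z.2.1⟩

open Set Filter Topology

/-- The inverse norm is integrable over discs in `ℂ`. -/
theorem lintegral_enorm_inv_closedBall_lt_top (ρ : ℝ) :
    ∫⁻ ζ in Metric.closedBall (0 : ℂ) ρ, ‖ζ⁻¹‖ₑ < ⊤ := by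
  rw [← lintegral_indicator Metric.isClosed_closedBall.measurableSet,
    ← Complex.lintegral_comp_polarCoord_symm]
  have hm : MeasurableSet polarCoord.target := polarCoord.open_target.measurableSet
  calc ∫⁻ p in polarCoord.target, ENNReal.ofReal p.1 •
        (Metric.closedBall (0 : ℂ) ρ).indicator (fun ζ => ‖ζ⁻¹‖ₑ) (Complex.polarCoord.symm p)
      ≤ ∫⁻ p in polarCoord.target, (Icc 0 ρ ×ˢ Icc (-Real.pi) Real.pi).indicator 1 p := by
        refine setLIntegral_mono' hm fun p hp => ?_
        rw [polarCoord_target] at hp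
        have hp1 : 0 < p.1 := hp.1
        by_cases h : Complex.polarCoord.symm p ∈ Metric.closedBall (0 : ℂ) ρ
        · have h' := h
          rw [mem_closedBall_zero_iff, Complex.norm_polarCoord_symm, abs_of_pos hp1] at h'
          rw [indicator_of_mem h, indicator_of_mem (by exact ⟨⟨hp1.le, h'⟩, Ioo_subset_Icc_self hp.2⟩)]
          rw [← ofReal_norm, norm_inv, Complex.norm_polarCoord_symm, abs_of_pos hp1, smul_eq_mul,
            ← ENNReal.ofReal_mul hp1.le, mul_inv_cancel₀ hp1.ne']
          simp
        · rw [indicator_of_notMem h]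
          simp
    _ ≤ ∫⁻ p : ℝ × ℝ, (Icc 0 ρ ×ˢ Icc (-Real.pi) Real.pi).indicator 1 p := setLIntegral_le_lintegral _ _
    _ = volume (Icc 0 ρ ×ˢ Icc (-Real.pi) Real.pi) :=
        lintegral_indicator_one (measurableSet_Icc.prod measurableSet_Icc)
    _ < ⊤ := (isCompact_Icc.prod isCompact_Icc).measure_lt_top

/-- The inverse is integrable over discs in `ℂ`. -/
theorem integrableOn_inv_closedBall (ρ : ℝ) :
    IntegrableOn (fun ζ : ℂ => ζ⁻¹) (Metric.closedBall 0 ρ) :=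
  ⟨measurable_inv.aestronglyMeasurable, lintegral_enorm_inv_closedBall_lt_top ρ⟩

/-- The derivative of `r ↦ φ (r e^{iθ})`. -/
theorem hasDerivAt_comp_ray {φ : ℂ → ℂ} (hφ : Differentiable ℝ φ) (θ r : ℝ) :
    HasDerivAt (fun r : ℝ => φ (r * Complex.exp (θ * Complex.I)))
      (fderiv ℝ φ (r * Complex.exp (θ * Complex.I)) (Complex.exp (θ * Complex.I))) r := by
  have h1 : HasDerivAt (fun r : ℝ => (r : ℂ) * Complex.exp (θ * Complex.I))
      (Complex.exp (θ * Complex.I)) r := by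
    simpa using (Complex.ofRealCLM.hasDerivAt (x := r)).mul_const (Complex.exp (θ * Complex.I))
  exact (hφ _).hasFDerivAt.comp_hasDerivAt r h1

/-- The derivative of `θ ↦ φ (r e^{iθ})`. -/
theorem hasDerivAt_comp_circle {φ : ℂ → ℂ} (hφ : Differentiable ℝ φ) (r θ : ℝ) :
    HasDerivAt (fun θ : ℝ => φ (r * Complex.exp (θ * Complex.I)))
      (r * fderiv ℝ φ (r * Complex.exp (θ * Complex.I))
        (Complex.I * Complex.exp (θ * Complex.I))) θ := by
  have h1 : HasDerivAt (fun θ : ℝ => (r : ℂ) * Complex.exp (θ * Complex.I))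
      (r • (Complex.I * Complex.exp (θ * Complex.I))) θ := by
    have h0 : HasDerivAt (fun θ : ℝ => (θ : ℂ) * Complex.I) Complex.I θ := by
      simpa using (Complex.ofRealCLM.hasDerivAt (x := θ)).mul_const Complex.I
    refine (h0.cexp.const_mul (r : ℂ)).congr_deriv ?_
    rw [Complex.real_smul]; ring
  have := (hφ _).hasFDerivAt.comp_hasDerivAt θ h1
  rw [map_smul, Complex.real_smul] at this
  exact this

/-- The Cauchy–Pompeiu formula for a compactly supported function: the Cauchy transform of its
`∂̄`-derivative recovers its value at the origin. -/
theorem integral_inv_mul_dbar {φ : ℂ → ℂ} (hφ : Differentiable ℝ φ) (hs : HasCompactSupport φ)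
    {C : ℝ} (hC : ∀ ζ, ‖fderiv ℝ φ ζ‖ ≤ C) :
    ∫ ζ : ℂ, ζ⁻¹ * (fderiv ℝ φ ζ 1 + Complex.I * fderiv ℝ φ ζ Complex.I)
      = -(2 * Real.pi) * φ 0 := by
  obtain ⟨ρ, hρ⟩ : ∃ ρ : ℝ, ∀ ζ : ℂ, ρ < ‖ζ‖ → φ ζ = 0 ∧ fderiv ℝ φ ζ = 0 := by
    obtain ⟨ρ, hρ⟩ := hs.isBounded.subset_closedBall (0 : ℂ)
    refine ⟨ρ, fun ζ hζ => ?_⟩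
    have : ζ ∉ tsupport φ := fun h => by
      have := hρ h
      rw [mem_closedBall_zero_iff] at this
      linarith
    exact ⟨image_eq_zero_of_notMem_tsupport this,
      by_contra fun h => this (support_fderiv_subset ℝ h)⟩
  let e : ℝ → ℂ := fun θ => Complex.exp (θ * Complex.I)
  have he : Continuous e := by fun_prop
  have hen : ∀ θ, ‖e θ‖ = 1 := fun θ => Complex.norm_exp_ofReal_mul_I θ
  have hmeas := measurable_fderiv ℝ φ
  have happ : ∀ g : ℝ × ℝ → ℂ, Measurable g →
      Measurable fun p : ℝ × ℝ => fderiv ℝ φ (p.1 * e p.2) (g p) := by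
    intro g hg
    have h1 : Measurable fun p : ℝ × ℝ => fderiv ℝ φ (p.1 * e p.2) :=
      hmeas.comp (by fun_prop)
    have : Measurable fun q : (ℂ →L[ℝ] ℂ) × ℂ => q.1 q.2 :=
      (isBoundedBilinearMap_apply.continuous).measurable
    exact this.comp (h1.prodMk hg)
  let A : ℝ × ℝ → ℂ := fun p => fderiv ℝ φ (p.1 * e p.2) (e p.2)
  let B : ℝ × ℝ → ℂ := fun p => fderiv ℝ φ (p.1 * e p.2) (Complex.I * e p.2)
  have hAm : Measurable A := happ _ (by fun_prop)
  have hBm : Measurable B := happ _ (by fun_prop)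
  have hbound : ∀ (p : ℝ × ℝ) (w : ℂ), ‖w‖ = 1 → ‖fderiv ℝ φ (p.1 * e p.2) w‖ ≤ C := by
    intro p w hw
    simpa [hw] using (fderiv ℝ φ (p.1 * e p.2)).le_of_opNorm_le (hC _) w
  have hAb : ∀ p, ‖A p‖ ≤ C := fun p => hbound p _ (hen _)
  have hBb : ∀ p, ‖B p‖ ≤ C := fun p => hbound p _ (by simp [hen])
  have hzero : ∀ (p : ℝ × ℝ), 0 < p.1 → ρ < p.1 → fderiv ℝ φ (p.1 * e p.2) = 0 := by
    intro p h0 h1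
    exact (hρ _ (by rw [norm_mul, hen, mul_one, Complex.norm_real, Real.norm_of_nonneg h0.le]; exact h1)).2
  have hAz : ∀ p : ℝ × ℝ, 0 < p.1 → ρ < p.1 → A p = 0 := fun p h0 h1 => by
    simp only [A, hzero p h0 h1]; rfl
  have hBz : ∀ p : ℝ × ℝ, 0 < p.1 → ρ < p.1 → B p = 0 := fun p h0 h1 => by
    simp only [B, hzero p h0 h1]; rfl
  have hint : ∀ G : ℝ × ℝ → ℂ, Measurable G → (∀ p, ‖G p‖ ≤ C) →
      (∀ p : ℝ × ℝ, 0 < p.1 → ρ < p.1 → G p = 0) →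
      IntegrableOn G (Ioi 0 ×ˢ Ioo (-Real.pi) Real.pi) := by
    intro G hG hb hz
    have h1 : IntegrableOn G (Ioc 0 ρ ×ˢ Ioo (-Real.pi) Real.pi) := by
      refine Measure.integrableOn_of_bounded (M := C) (ne_of_lt ?_) hG.aestronglyMeasurable
        (Eventually.of_forall hb)
      refine lt_of_le_of_lt (measure_mono (prod_mono Ioc_subset_Icc_self Ioo_subset_Icc_self)) ?_
      exact (isCompact_Icc.prod isCompact_Icc).measure_lt_top
    refine h1.of_forall_sdiff_eq_zero (measurableSet_Ioi.prod measurableSet_Ioo) ?_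
    rintro p ⟨hp, hp'⟩
    refine hz p hp.1 ?_
    by_contra h
    exact hp' ⟨⟨hp.1, not_lt.1 h⟩, hp.2⟩
  have hAi := hint A hAm hAb hAz
  have hBi := hint B hBm hBb hBz
  rw [← Complex.integral_comp_polarCoord_symm, polarCoord_target]
  have hpt : ∀ p ∈ Ioi (0 : ℝ) ×ˢ Ioo (-Real.pi) Real.pi,
      p.1 • ((Complex.polarCoord.symm p)⁻¹ * (fderiv ℝ φ (Complex.polarCoord.symm p) 1 +
        Complex.I * fderiv ℝ φ (Complex.polarCoord.symm p) Complex.I))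
      = A p + Complex.I * B p := by
    intro p hp
    have hp1 : (p.1 : ℂ) ≠ 0 := by exact_mod_cast (ne_of_gt hp.1)
    have hsym : Complex.polarCoord.symm p = p.1 * e p.2 := by
      rw [Complex.polarCoord_symm_apply]
      simp only [e, Complex.exp_mul_I, Complex.ofReal_cos, Complex.ofReal_sin]
    rw [hsym]
    simp only [A, B]
    set D := fderiv ℝ φ (p.1 * e p.2)
    have hlin : ∀ x y : ℝ, D (x + y * Complex.I) = x * D 1 + y * D Complex.I := by
      intro x y
      have : (x + y * Complex.I : ℂ) = x • (1 : ℂ) + y • Complex.I := by simp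
      rw [this, map_add, map_smul, map_smul]; simp
    have hE : e p.2 = (Real.cos p.2 : ℝ) + (Real.sin p.2 : ℝ) * Complex.I := by
      simp only [e, Complex.exp_mul_I, Complex.ofReal_cos, Complex.ofReal_sin]
    have hE' : Complex.I * e p.2 = ((-Real.sin p.2 : ℝ) : ℂ) + (Real.cos p.2 : ℝ) * Complex.I := by
      rw [hE]; push_cast; ring_nf; rw [Complex.I_sq]; ring
    have hinv : (e p.2)⁻¹ = (Real.cos p.2 : ℝ) - (Real.sin p.2 : ℝ) * Complex.I := by
      rw [← Complex.exp_neg, ← neg_mul, ← Complex.ofReal_neg, Complex.exp_mul_I]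
      simp [sub_eq_add_neg]
    rw [hE', hlin, mul_inv, hinv, hE, hlin, Complex.real_smul]
    push_cast
    field_simp
    ring_nf
    rw [Complex.I_sq]; ring
  rw [setIntegral_congr_fun (measurableSet_Ioi.prod measurableSet_Ioo) hpt,
    integral_add hAi (hBi.const_mul Complex.I), integral_const_mul]
  have hA : ∫ p in Ioi (0 : ℝ) ×ˢ Ioo (-Real.pi) Real.pi, A p = -(2 * Real.pi) * φ 0 := by
    have hsw := setIntegral_prod_swap (μ := (volume : Measure ℝ)) (ν := (volume : Measure ℝ))
      (Ioi (0 : ℝ)) (Ioo (-Real.pi) Real.pi) A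
    rw [Measure.volume_eq_prod, ← hsw, setIntegral_prod]
    · have : ∀ θ ∈ Ioo (-Real.pi) Real.pi, ∫ r in Ioi (0 : ℝ), A (Prod.swap (θ, r)) = - φ 0 := by
        intro θ _
        have hi : IntegrableOn (fun r => A (r, θ)) (Ioi 0) := by
          have h1 : IntegrableOn (fun r => A (r, θ)) (Ioc 0 ρ) :=
            Measure.integrableOn_of_bounded (M := C) (by simp)
              (hAm.comp (by fun_prop)).aestronglyMeasurable
              (Eventually.of_forall fun r => hAb _)
          refine h1.of_forall_sdiff_eq_zero measurableSet_Ioi ?_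
          rintro r ⟨hr, hr'⟩
          refine hAz _ hr ?_
          by_contra h
          exact hr' ⟨hr, not_lt.1 h⟩
        have hd := fun r : ℝ => hasDerivAt_comp_ray hφ θ r
        have ht : Tendsto (fun r : ℝ => φ (r * Complex.exp (θ * Complex.I))) atTop (𝓝 0) := by
          refine tendsto_const_nhds.congr' ?_
          filter_upwards [eventually_gt_atTop ρ, eventually_gt_atTop 0] with r h1 h0
          refine (hρ _ ?_).1.symm
          rw [norm_mul, Complex.norm_exp_ofReal_mul_I, mul_one, Complex.norm_real,
            Real.norm_of_nonneg h0.le]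
          exact h1
        have := integral_Ioi_of_hasDerivAt_of_tendsto (hd 0).continuousAt.continuousWithinAt
          (fun r _ => hd r) hi ht
        simpa using this
      rw [setIntegral_congr_fun measurableSet_Ioo this, setIntegral_const]
      have hpi := Real.pi_pos
      simp only [Measure.real, Real.volume_Ioo, Complex.real_smul]
      rw [ENNReal.toReal_ofReal (by linarith)]
      push_cast; ring
    · rw [IntegrableOn, Measure.volume_eq_prod, ← Measure.prod_restrict] at hAi
      have := hAi.swap
      rwa [Measure.prod_restrict] at this
  have hB : ∫ p in Ioi (0 : ℝ) ×ˢ Ioo (-Real.pi) Real.pi, B p = 0 := by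
    rw [Measure.volume_eq_prod, setIntegral_prod _ hBi]
    refine setIntegral_eq_zero_of_forall_eq_zero fun r hr => ?_
    have hr0 : (r : ℂ) ≠ 0 := by exact_mod_cast (ne_of_gt hr)
    have hpi := Real.pi_pos
    have hi : IntervalIntegrable (fun θ => (r : ℂ) * B (r, θ)) volume (-Real.pi) Real.pi := by
      refine IntervalIntegrable.const_mul ?_ _
      rw [intervalIntegrable_iff]
      exact Measure.integrableOn_of_bounded (M := C) (by simp)
        (hBm.comp (by fun_prop)).aestronglyMeasurable
        (Eventually.of_forall fun θ => hBb _)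
    have := intervalIntegral.integral_eq_sub_of_hasDerivAt
      (fun θ _ => hasDerivAt_comp_circle hφ r θ) hi
    rw [intervalIntegral.integral_const_mul, intervalIntegral.integral_of_le (by linarith),
      integral_Ioc_eq_integral_Ioo] at this
    have h2 : Complex.exp ((Real.pi : ℝ) * Complex.I) = Complex.exp ((-Real.pi : ℝ) * Complex.I) := by
      rw [Complex.exp_pi_mul_I]; push_cast; rw [neg_mul, Complex.exp_neg, Complex.exp_pi_mul_I]; norm_num
    rw [h2, sub_self] at this
    exact (mul_eq_zero.1 this).resolve_left hr0
  rw [hA, hB, mul_zero, add_zero]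

section CauchyTransform

variable {X : Type*} [NormedAddCommGroup X] [NormedSpace ℂ X]

/-- The Cauchy–Riemann operator in the direction `w` (twice the `∂̄`-derivative). -/
noncomputable def dbar (w : X) (g : X → ℂ) (z : X) : ℂ :=
  fderiv ℝ g z w + Complex.I * fderiv ℝ g z (Complex.I • w)

/-- The Cauchy transform of `a` along the complex lines parallel to `v`. -/
noncomputable def cauchyTransform (v : X) (a : X → ℂ) (z : X) : ℂ :=
  ∫ ζ : ℂ, ζ⁻¹ * a (z - ζ • v)

/-- A real differentiable function all of whose `∂̄`-derivatives vanish is holomorphic. -/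
theorem differentiableAt_of_dbar_eq_zero {g : X → ℂ} {z : X} (hg : DifferentiableAt ℝ g z)
    (h : ∀ w, dbar w g z = 0) : DifferentiableAt ℂ g z := by
  rw [differentiableAt_iff_restrictScalars ℝ hg]
  have hI : ∀ w, fderiv ℝ g z (Complex.I • w) = Complex.I * fderiv ℝ g z w := by
    intro w
    have := h w
    rw [dbar] at this
    linear_combination (-Complex.I) * this + fderiv ℝ g z (Complex.I • w) * Complex.I_sq
  refine ⟨{ fderiv ℝ g z with map_smul' := fun c w => ?_ }, rfl⟩
  have hc : c • w = c.re • w + c.im • (Complex.I • w) := by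
    conv_lhs => rw [← Complex.re_add_im c]
    rw [add_smul, mul_smul, Complex.coe_smul, Complex.coe_smul]
  have : fderiv ℝ g z (c • w) = c • fderiv ℝ g z w := by
    rw [hc, map_add, map_smul, map_smul, hI]
    conv_rhs => rw [← Complex.re_add_im c]
    simp only [Complex.real_smul, smul_eq_mul]; ring
  exact this

/-- The `∂̄`-derivatives of a holomorphic function vanish. -/
theorem dbar_eq_zero {g : X → ℂ} {z : X} (hg : DifferentiableAt ℂ g z) (w : X) :
    dbar w g z = 0 := by
  rw [dbar, hg.fderiv_restrictScalars ℝ]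
  simp only [ContinuousLinearMap.coe_restrictScalars', map_smul, smul_eq_mul]
  rw [← mul_assoc, Complex.I_mul_I]; ring

theorem dbar_add {f g : X → ℂ} {z : X} (hf : DifferentiableAt ℝ f z) (hg : DifferentiableAt ℝ g z)
    (w : X) : dbar w (fun z => f z + g z) z = dbar w f z + dbar w g z := by
  simp only [dbar, fderiv_fun_add hf hg, add_apply]
  ring

theorem dbar_mul {f g : X → ℂ} {z : X} (hf : DifferentiableAt ℝ f z) (hg : DifferentiableAt ℝ g z)
    (w : X) : dbar w (fun z => f z * g z) z = f z * dbar w g z + g z * dbar w f z := by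
  simp only [dbar, fderiv_fun_mul hf hg, add_apply,
    smul_apply, smul_eq_mul]
  ring

theorem dbar_congr {f g : X → ℂ} {z : X} (h : f =ᶠ[𝓝 z] g) (w : X) : dbar w f z = dbar w g z := by
  rw [dbar, dbar, h.fderiv_eq]

theorem dbar_const (c : ℂ) (w z : X) : dbar w (fun _ => c) z = 0 := by
  simp [dbar]

theorem norm_dbar_le (w : X) (g : X → ℂ) (z : X) : ‖dbar w g z‖ ≤ 2 * ‖w‖ * ‖fderiv ℝ g z‖ := by
  have h1 := (fderiv ℝ g z).le_opNorm w
  have h2 := (fderiv ℝ g z).le_opNorm (Complex.I • w)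
  rw [norm_smul, Complex.norm_I, one_mul] at h2
  calc ‖dbar w g z‖ ≤ ‖fderiv ℝ g z w‖ + ‖Complex.I * fderiv ℝ g z (Complex.I • w)‖ := norm_add_le _ _
    _ ≤ 2 * ‖w‖ * ‖fderiv ℝ g z‖ := by
      rw [norm_mul, Complex.norm_I, one_mul]; linarith

/-- `∂̄`-derivatives of a smooth function are smooth. -/
theorem contDiff_dbar {g : X → ℂ} {n m : WithTop ℕ∞} (hg : ContDiff ℝ n g) (hmn : m + 1 ≤ n)
    (w : X) : ContDiff ℝ m (dbar w g) := by
  have h := hg.fderiv_right hmn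
  exact (h.clm_apply contDiff_const).add (contDiff_const.mul (h.clm_apply contDiff_const))

/-- `∂̄`-derivatives commute. -/
theorem dbar_comm {g : X → ℂ} (hg : ContDiff ℝ 2 g) (v w z : X) :
    dbar w (dbar v g) z = dbar v (dbar w g) z := by
  have h1 : ContDiff ℝ 1 (fderiv ℝ g) := hg.fderiv_right (by norm_num)
  have h2 : DifferentiableAt ℝ (fderiv ℝ g) z := (h1.differentiable one_ne_zero) z
  have hs : IsSymmSndFDerivAt ℝ g z := hg.contDiffAt.isSymmSndFDerivAt (by simp)
  have key : ∀ v w : X, fderiv ℝ (dbar v g) z w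
      = fderiv ℝ (fderiv ℝ g) z w v + Complex.I * fderiv ℝ (fderiv ℝ g) z w (Complex.I • v) := by
    intro v w
    have h3 := ((h2.hasFDerivAt.clm_apply (hasFDerivAt_const v z)).add
      ((h2.hasFDerivAt.clm_apply (hasFDerivAt_const (Complex.I • v) z)).const_mul Complex.I))
    have : fderiv ℝ (dbar v g) z = _ := h3.fderiv
    rw [this]
    simp
  rw [dbar, dbar, key, key, key, key]
  rw [hs.eq w v, hs.eq w (Complex.I • v), hs.eq (Complex.I • w) v,
    hs.eq (Complex.I • w) (Complex.I • v)]
  ring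

/-- Functions bounded with bounded support are integrable against the Cauchy kernel. -/
theorem integrable_inv_smul {Y : Type*} [NormedAddCommGroup Y] [NormedSpace ℂ Y] {G : ℂ → Y}
    (hG : AEStronglyMeasurable G) {ρ C : ℝ} (hz : ∀ ζ, ρ < ‖ζ‖ → G ζ = 0) (hb : ∀ ζ, ‖G ζ‖ ≤ C) :
    Integrable (fun ζ => ζ⁻¹ • G ζ) := by
  have h := (integrableOn_inv_closedBall ρ).smul_bdd C hG.restrict (Eventually.of_forall hb)
  have h' : IntegrableOn (fun ζ => ζ⁻¹ • G ζ) (Metric.closedBall 0 ρ) := h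
  rw [← integrableOn_univ]
  refine h'.of_forall_sdiff_eq_zero MeasurableSet.univ fun ζ hζ => ?_
  rw [hz ζ, smul_zero]
  simpa using hζ.2

/-- Functions supported in a strip transverse to `v` have bounded support on the lines parallel
to `v`. -/
theorem norm_le_of_strip {v : X} {L : X →L[ℝ] ℂ} (hL : ∀ ζ : ℂ, L (ζ • v) = ζ) {M : ℝ} {z : X}
    {ζ : ℂ} (h : ‖L (z - ζ • v)‖ ≤ M) : ‖ζ‖ ≤ ‖L z‖ + M := by
  rw [map_sub, hL] at h
  have := norm_sub_norm_le ζ (L z)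
  rw [norm_sub_rev] at this
  linarith

theorem norm_le_of_fderiv_ne_zero {L : X →L[ℝ] ℂ} {a : X → ℂ} {M : ℝ}
    (hM : ∀ z, a z ≠ 0 → ‖L z‖ ≤ M) {z : X} (h : fderiv ℝ a z ≠ 0) : ‖L z‖ ≤ M := by
  have hc : IsClosed {z | ‖L z‖ ≤ M} := isClosed_le (by fun_prop) continuous_const
  exact closure_minimal (fun z hz => hM z hz) hc (support_fderiv_subset ℝ h)

theorem isCompact_line_segment (z v : X) (ρ : ℝ) :
    IsCompact ((fun ζ : ℂ => z - ζ • v) '' Metric.closedBall 0 ρ) :=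
  (isCompact_closedBall _ _).image (by fun_prop)

/-- The Cauchy transform along `v` of a `∂̄`-derivative in the direction `v`. -/
theorem cauchyTransform_dbar {v : X} {L : X →L[ℝ] ℂ} (hL : ∀ ζ : ℂ, L (ζ • v) = ζ) {b : X → ℂ}
    (hb : Differentiable ℝ b) (hbd : ∀ K, IsCompact K → ∃ C, ∀ z ∈ K, ‖fderiv ℝ b z‖ ≤ C) {M : ℝ}
    (hM : ∀ z, b z ≠ 0 → ‖L z‖ ≤ M) (z : X) :
    cauchyTransform v (dbar v b) z = 2 * Real.pi * b z := by
  let ℓ : ℂ →L[ℝ] X := (ContinuousLinearMap.toSpanSingleton ℂ v).restrictScalars ℝ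
  have hℓ : ∀ ζ, ℓ ζ = ζ • v := fun ζ => rfl
  have hφ : ∀ ζ : ℂ, HasFDerivAt (fun ζ : ℂ => b (z - ζ • v))
      ((fderiv ℝ b (z - ζ • v)).comp (-ℓ)) ζ := by
    intro ζ
    have h1 : HasFDerivAt (fun ζ : ℂ => z - ζ • v) (-ℓ) ζ := ℓ.hasFDerivAt.const_sub z
    exact (hb _).hasFDerivAt.comp ζ h1
  have hz : ∀ ζ : ℂ, ‖L z‖ + M < ‖ζ‖ → b (z - ζ • v) = 0 ∧ fderiv ℝ b (z - ζ • v) = 0 := by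
    intro ζ hζ
    constructor <;> by_contra h
    · exact absurd (norm_le_of_strip hL (hM _ h)) (not_le.2 hζ)
    · exact absurd (norm_le_of_strip hL (norm_le_of_fderiv_ne_zero hM h)) (not_le.2 hζ)
  obtain ⟨C, hC⟩ := hbd _ (isCompact_line_segment z v (‖L z‖ + M))
  have hs : HasCompactSupport fun ζ : ℂ => b (z - ζ • v) :=
    HasCompactSupport.intro (isCompact_closedBall (0 : ℂ) (‖L z‖ + M)) fun ζ hζ =>
      (hz ζ (by simpa using hζ)).1
  have hbound : ∀ ζ, ‖fderiv ℝ (fun ζ : ℂ => b (z - ζ • v)) ζ‖ ≤ max C 0 * ‖-ℓ‖ := by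
    intro ζ
    rw [(hφ ζ).fderiv]
    refine (ContinuousLinearMap.opNorm_comp_le _ _).trans ?_
    gcongr
    by_cases h : ‖L z‖ + M < ‖ζ‖
    · rw [(hz ζ h).2]; simp
    · exact (hC _ ⟨ζ, by simpa using h, rfl⟩).trans (le_max_left _ _)
  have := integral_inv_mul_dbar (fun ζ => (hφ ζ).differentiableAt) hs hbound
  rw [zero_smul, sub_zero] at this
  rw [cauchyTransform, ← neg_inj, ← neg_mul, ← this, ← integral_neg]
  refine integral_congr_ae (Eventually.of_forall fun ζ => ?_)
  simp only [(hφ ζ).fderiv, dbar, ContinuousLinearMap.comp_apply, neg_apply,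
    hℓ, one_smul, map_neg]
  ring

variable [FiniteDimensional ℂ X] [MeasurableSpace X] [BorelSpace X]

/-- Differentiation of the Cauchy transform under the integral sign. -/
theorem hasFDerivAt_cauchyTransform {v : X} {L : X →L[ℝ] ℂ} (hL : ∀ ζ : ℂ, L (ζ • v) = ζ)
    {a : X → ℂ} (ha : Differentiable ℝ a)
    (hbd : ∀ K, IsCompact K → ∃ C, ∀ z ∈ K, ‖fderiv ℝ a z‖ ≤ C) {M : ℝ}
    (hM : ∀ z, a z ≠ 0 → ‖L z‖ ≤ M) (z₀ : X) :
    HasFDerivAt (cauchyTransform v a) (∫ ζ : ℂ, ζ⁻¹ • fderiv ℝ a (z₀ - ζ • v)) z₀ ∧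
      Integrable fun ζ : ℂ => ζ⁻¹ • fderiv ℝ a (z₀ - ζ • v) := by
  have : FiniteDimensional ℝ X := FiniteDimensional.complexToReal X
  have : ProperSpace X := FiniteDimensional.proper ℝ X
  set ρ : ℝ := ‖L‖ * (‖z₀‖ + 1) + M with hρ
  have hρz : ∀ z ∈ Metric.ball z₀ 1, ‖L z‖ + M ≤ ρ := by
    intro z hz
    have h1 : ‖z‖ ≤ ‖z₀‖ + 1 := by
      have := norm_sub_norm_le z z₀
      rw [mem_ball_iff_norm] at hz
      linarith
    have := L.le_opNorm_of_le h1
    linarith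
  have hz : ∀ z ∈ Metric.ball z₀ 1, ∀ ζ : ℂ, ρ < ‖ζ‖ →
      a (z - ζ • v) = 0 ∧ fderiv ℝ a (z - ζ • v) = 0 := by
    intro z hz ζ hζ
    have hlt := (hρz z hz).trans_lt hζ
    constructor <;> by_contra h
    · exact absurd (norm_le_of_strip hL (hM _ h)) (not_le.2 hlt)
    · exact absurd (norm_le_of_strip hL (norm_le_of_fderiv_ne_zero hM h)) (not_le.2 hlt)
  let T : Set X := (fun p : X × ℂ => p.1 - p.2 • v) '' (Metric.closedBall z₀ 1 ×ˢ Metric.closedBall 0 ρ)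
  have hT : IsCompact T :=
    ((isCompact_closedBall _ _).prod (isCompact_closedBall _ _)).image (by fun_prop)
  obtain ⟨C, hC⟩ := hbd T hT
  obtain ⟨C', hC'⟩ := hT.exists_bound_of_continuousOn ha.continuous.continuousOn
  have hDb : ∀ z ∈ Metric.ball z₀ 1, ∀ ζ : ℂ, ‖fderiv ℝ a (z - ζ • v)‖ ≤ max C 0 := by
    intro z hz' ζ
    by_cases h : ρ < ‖ζ‖
    · rw [(hz z hz' ζ h).2]; simp
    · exact (hC _ ⟨(z, ζ), ⟨Metric.ball_subset_closedBall hz', by simpa using h⟩, rfl⟩).trans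
        (le_max_left _ _)
  have hab : ∀ z ∈ Metric.ball z₀ 1, ∀ ζ : ℂ, ‖a (z - ζ • v)‖ ≤ max C' 0 := by
    intro z hz' ζ
    by_cases h : ρ < ‖ζ‖
    · rw [(hz z hz' ζ h).1]; simp
    · exact (hC' _ ⟨(z, ζ), ⟨Metric.ball_subset_closedBall hz', by simpa using h⟩, rfl⟩).trans
        (le_max_left _ _)
  have hz₀ : z₀ ∈ Metric.ball z₀ 1 := Metric.mem_ball_self one_pos
  have hDm : AEStronglyMeasurable fun ζ : ℂ => fderiv ℝ a (z₀ - ζ • v) :=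
    ((measurable_fderiv ℝ a).comp (by fun_prop)).aestronglyMeasurable
  have ham : ∀ z, AEStronglyMeasurable fun ζ : ℂ => a (z - ζ • v) := fun z =>
    (ha.continuous.comp (by fun_prop)).aestronglyMeasurable
  have hDi : Integrable fun ζ : ℂ => ζ⁻¹ • fderiv ℝ a (z₀ - ζ • v) :=
    integrable_inv_smul hDm (fun ζ h => (hz z₀ hz₀ ζ h).2) (hDb z₀ hz₀)
  refine ⟨?_, hDi⟩
  let bound : ℂ → ℝ := (Metric.closedBall (0 : ℂ) ρ).indicator fun ζ => ‖ζ⁻¹‖ * max C 0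
  refine hasFDerivAt_integral_of_dominated_of_fderiv_le (bound := bound)
    (F' := fun z ζ => ζ⁻¹ • fderiv ℝ a (z - ζ • v))
    (Metric.ball_mem_nhds z₀ one_pos) (Eventually.of_forall fun z => ?_) ?_ hDi.1 ?_ ?_ ?_
  · exact measurable_inv.aestronglyMeasurable.mul (ham z)
  · exact integrable_inv_smul (ham z₀) (fun ζ h => (hz z₀ hz₀ ζ h).1) (hab z₀ hz₀)
  · refine Eventually.of_forall fun ζ z hz' => ?_
    by_cases h : ρ < ‖ζ‖
    · rw [norm_smul, (hz z hz' ζ h).2, norm_zero, mul_zero]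
      exact indicator_nonneg (fun _ _ => by positivity) _
    · rw [show bound ζ = ‖ζ⁻¹‖ * max C 0 from indicator_of_mem (by simpa using h) _, norm_smul]
      gcongr
      exact hDb z hz' ζ
  · exact IntegrableOn.integrable_indicator ((integrableOn_inv_closedBall ρ).norm.mul_const _)
      Metric.isClosed_closedBall.measurableSet
  · refine Eventually.of_forall fun ζ z _ => ?_
    have h1 : HasFDerivAt (fun z => a (z - ζ • v)) (fderiv ℝ a (z - ζ • v)) z := by
      have := (ha (z - ζ • v)).hasFDerivAt.comp z ((hasFDerivAt_id z).sub_const (ζ • v))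
      rw [ContinuousLinearMap.comp_id] at this
      exact this
    exact h1.const_mul ζ⁻¹

/-- The Cauchy transform commutes with `∂̄`-derivatives. -/
theorem dbar_cauchyTransform {v : X} {L : X →L[ℝ] ℂ} (hL : ∀ ζ : ℂ, L (ζ • v) = ζ)
    {a : X → ℂ} (ha : Differentiable ℝ a)
    (hbd : ∀ K, IsCompact K → ∃ C, ∀ z ∈ K, ‖fderiv ℝ a z‖ ≤ C) {M : ℝ}
    (hM : ∀ z, a z ≠ 0 → ‖L z‖ ≤ M) (w z : X) :
    dbar w (cauchyTransform v a) z = cauchyTransform v (dbar w a) z := by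
  obtain ⟨h, hi⟩ := hasFDerivAt_cauchyTransform hL ha hbd hM z
  rw [dbar, h.fderiv, ContinuousLinearMap.integral_apply hi, ContinuousLinearMap.integral_apply hi,
    ← integral_const_mul, ← integral_add (hi.apply_continuousLinearMap w)
      ((hi.apply_continuousLinearMap _).const_mul _), cauchyTransform]
  refine integral_congr_ae (Eventually.of_forall fun ζ => ?_)
  simp only [dbar, smul_apply, smul_eq_mul]
  ring

end CauchyTransform

section SeveralVariables

variable {X : Type*} [NormedAddCommGroup X] [NormedSpace ℂ X]

/-- The identity theorem for holomorphic functions of several variables. -/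
theorem eqOn_of_isPreconnected_of_eventuallyEq {U : Set X} (hU : IsOpen U) (hc : IsPreconnected U)
    {f g : X → ℂ} (hf : DifferentiableOn ℂ f U) (hg : DifferentiableOn ℂ g U) {z₀ : X}
    (hz₀ : z₀ ∈ U) (h : f =ᶠ[𝓝 z₀] g) : EqOn f g U := by
  have hS : IsOpen {z | f =ᶠ[𝓝 z] g} := isOpen_setOfPred_eventually_nhds
  suffices U ⊆ {z | f =ᶠ[𝓝 z] g} from fun z hz => (this hz).eq_of_nhds
  refine hc.subset_of_closure_inter_subset hS ⟨z₀, hz₀, h⟩ ?_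
  rintro q ⟨hq, hqU⟩
  obtain ⟨ε, hε, hb⟩ := Metric.isOpen_iff.1 hU q hqU
  obtain ⟨p, hpS, hp⟩ := mem_closure_iff_nhds.1 hq _ (Metric.ball_mem_nhds q hε) |>.imp
    fun p h => h.symm
  refine mem_of_superset (Metric.ball_mem_nhds q hε) fun z hz => ?_
  let line : ℂ → X := fun t => p + t • (z - p)
  have hline : Differentiable ℂ line := by fun_prop
  let T : Set ℂ := line ⁻¹' Metric.ball q ε
  have hTo : IsOpen T := Metric.isOpen_ball.preimage hline.continuous
  have hTc : Convex ℝ T := by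
    intro s hs t ht α β hα hβ hαβ
    have : line (α • s + β • t) = α • line s + β • line t := by
      simp only [line, Complex.real_smul, add_smul, mul_smul, smul_add, Complex.coe_smul]
      nth_rw 1 [← one_smul ℝ p, ← hαβ]
      rw [add_smul]; abel
    change line _ ∈ Metric.ball q ε
    rw [this]
    exact convex_ball q ε hs ht hα hβ hαβ
  have h0 : (0 : ℂ) ∈ T := by simpa [T, line] using hp
  have h1 : (1 : ℂ) ∈ T := by simpa [T, line] using hz
  have hcomp : ∀ {k : X → ℂ}, DifferentiableOn ℂ k U → AnalyticOnNhd ℂ (k ∘ line) T := fun hk =>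
    ((hk.mono hb).comp hline.differentiableOn fun _ ht => ht).analyticOnNhd hTo
  have he : f ∘ line =ᶠ[𝓝 0] g ∘ line := by
    have : Tendsto line (𝓝 0) (𝓝 p) := by
      simpa [line] using hline.continuous.tendsto 0
    exact this.eventually hpS
  have := (hcomp hf).eqOn_of_preconnected_of_eventuallyEq (hcomp hg) hTc.isPreconnected h0 he h1
  simpa [line] using this

/-- The derivative of a holomorphic function is locally bounded. -/
theorem exists_eventually_norm_fderiv_le {U : Set X} (hU : IsOpen U) {f : X → ℂ}
    (hf : DifferentiableOn ℂ f U) {z : X} (hz : z ∈ U) : ∃ C, ∀ᶠ y in 𝓝 z, ‖fderiv ℝ f y‖ ≤ C := by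
  have hc : ContinuousAt f z := (hf.differentiableAt (hU.mem_nhds hz)).continuousAt
  have h1 : ∀ᶠ y in 𝓝 z, y ∈ U ∧ dist (f y) (f z) < 1 :=
    (hU.mem_nhds hz |> eventually_mem_set.2).and (hc.eventually (Metric.ball_mem_nhds _ one_pos))
  obtain ⟨ε, hε, hb⟩ := Metric.eventually_nhds_iff_ball.1 h1
  refine ⟨2 / (ε / 2), ?_⟩
  filter_upwards [Metric.ball_mem_nhds z (half_pos hε)] with y hy
  have hsub : Metric.ball y (ε / 2) ⊆ Metric.ball z ε := by
    refine Metric.ball_subset_ball' ?_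
    rw [Metric.mem_ball] at hy; linarith
  have hyd : DifferentiableAt ℂ f y := hf.differentiableAt
    (hU.mem_nhds (hb y (hsub (Metric.mem_ball_self (half_pos hε)))).1)
  rw [hyd.fderiv_restrictScalars ℝ, ContinuousLinearMap.norm_restrictScalars]
  refine Complex.norm_fderiv_le_div_of_mapsTo_ball (hf.mono fun w hw => (hb w (hsub hw)).1)
    (fun w hw => ?_) (half_pos hε)
  have h2 := (hb w (hsub hw)).2
  have h3 := (hb y (hsub (Metric.mem_ball_self (half_pos hε)))).2
  have := dist_triangle_right (f w) (f y) (f z)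
  rw [Metric.mem_closedBall]; linarith

/-- A locally bounded function is bounded on compact sets. -/
theorem exists_bound_of_locally_bounded {Y Z : Type*} [TopologicalSpace Y] [NormedAddCommGroup Z]
    {g : Y → Z} (h : ∀ z, ∃ C, ∀ᶠ y in 𝓝 z, ‖g y‖ ≤ C) (K : Set Y) (hK : IsCompact K) :
    ∃ C, ∀ z ∈ K, ‖g z‖ ≤ C := by
  refine hK.induction_on (p := fun K => ∃ C, ∀ z ∈ K, ‖g z‖ ≤ C) ⟨0, by simp⟩
    (fun s t hst ⟨C, hC⟩ => ⟨C, fun z hz => hC z (hst hz)⟩) ?_ ?_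
  · rintro s t ⟨C, hC⟩ ⟨D, hD⟩
    refine ⟨max C D, fun z hz => ?_⟩
    rcases hz with hz | hz
    · exact (hC z hz).trans (le_max_left _ _)
    · exact (hD z hz).trans (le_max_right _ _)
  · intro z _
    obtain ⟨C, hC⟩ := h z
    exact ⟨_, mem_nhdsWithin_of_mem_nhds hC, C, fun y hy => hy⟩

variable [FiniteDimensional ℂ X] [MeasurableSpace X] [BorelSpace X]

/-- The `L²` bound for the Cauchy transform along lines over sets where only a disc of fixed radius
contributes. -/
theorem lintegral_sq_cauchyTransform_le (μ : Measure X) [μ.IsAddHaarMeasure] (v : X) {a : X → ℂ}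
    (ha : Continuous a) {S : Set X} (hSm : MeasurableSet S) {ρ : ℝ}
    (hS : ∀ z ∈ S, ∀ ζ : ℂ, a (z - ζ • v) ≠ 0 → ‖ζ‖ ≤ ρ) :
    ∫⁻ z in S, ‖cauchyTransform v a z‖ₑ ^ 2 ∂μ ≤
      (∫⁻ ζ in Metric.closedBall (0 : ℂ) ρ, ‖ζ⁻¹‖ₑ) ^ 2 * ∫⁻ z, ‖a z‖ₑ ^ 2 ∂μ := by
  have : FiniteDimensional ℝ X := FiniteDimensional.complexToReal X
  have : ProperSpace X := FiniteDimensional.proper ℝ X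
  set B := Metric.closedBall (0 : ℂ) ρ
  have hk : Measurable fun ζ : ℂ => ‖ζ⁻¹‖ₑ := measurable_inv.enorm
  let ν : Measure ℂ := (volume.restrict B).withDensity fun ζ => ‖ζ⁻¹‖ₑ
  have hν : ν univ = ∫⁻ ζ in B, ‖ζ⁻¹‖ₑ := by
    rw [withDensity_apply _ MeasurableSet.univ, Measure.restrict_univ]
  have : IsFiniteMeasure ν :=
    ⟨by rw [hν]; exact lintegral_enorm_inv_closedBall_lt_top ρ⟩
  have hpair : Measurable fun p : X × ℂ => ‖a (p.1 - p.2 • v)‖ₑ ^ 2 :=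
    ((ha.comp (by fun_prop : Continuous fun p : X × ℂ => p.1 - p.2 • v)).enorm.measurable.pow_const 2)
  have hz : ∀ z, Measurable fun ζ : ℂ => ‖a (z - ζ • v)‖ₑ := fun z =>
    (ha.comp (by fun_prop : Continuous fun ζ : ℂ => z - ζ • v)).enorm.measurable
  have hpt : ∀ z ∈ S, ‖cauchyTransform v a z‖ₑ ^ 2 ≤ ν univ * ∫⁻ ζ, ‖a (z - ζ • v)‖ₑ ^ 2 ∂ν := by
    intro z hzS
    have h1 : ‖cauchyTransform v a z‖ₑ ≤ ∫⁻ ζ, ‖a (z - ζ • v)‖ₑ ∂ν := by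
      refine (enorm_integral_le_lintegral_enorm _).trans ?_
      rw [lintegral_withDensity_eq_lintegral_mul _ hk (hz z),
        ← lintegral_indicator Metric.isClosed_closedBall.measurableSet]
      refine lintegral_mono fun ζ => ?_
      by_cases h : ζ ∈ B
      · rw [indicator_of_mem h, enorm_mul]; rfl
      · have : a (z - ζ • v) = 0 := by
          by_contra h'
          exact h (by simpa [B] using hS z hzS ζ h')
        rw [this]; simp
    have h2 := ENNReal.lintegral_mul_le_Lp_mul_Lq ν Real.HolderConjugate.two_two
      (f := fun _ => 1) (g := fun ζ => ‖a (z - ζ • v)‖ₑ) aemeasurable_const (hz z).aemeasurable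
    simp only [Pi.mul_apply, one_mul, one_pow, lintegral_const, ENNReal.rpow_two] at h2
    calc ‖cauchyTransform v a z‖ₑ ^ 2 ≤ ((ν univ) ^ (1 / 2 : ℝ) *
          (∫⁻ ζ, ‖a (z - ζ • v)‖ₑ ^ 2 ∂ν) ^ (1 / 2 : ℝ)) ^ 2 := by
          gcongr; exact h1.trans h2
      _ = ν univ * ∫⁻ ζ, ‖a (z - ζ • v)‖ₑ ^ 2 ∂ν := by
          rw [mul_pow, ← ENNReal.rpow_two, ← ENNReal.rpow_two, ← ENNReal.rpow_mul,
            ← ENNReal.rpow_mul]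
          norm_num
  calc ∫⁻ z in S, ‖cauchyTransform v a z‖ₑ ^ 2 ∂μ
      ≤ ∫⁻ z in S, ν univ * ∫⁻ ζ, ‖a (z - ζ • v)‖ₑ ^ 2 ∂ν ∂μ := setLIntegral_mono' hSm hpt
    _ ≤ ∫⁻ z, ν univ * ∫⁻ ζ, ‖a (z - ζ • v)‖ₑ ^ 2 ∂ν ∂μ := setLIntegral_le_lintegral _ _
    _ = ν univ * ∫⁻ ζ, ∫⁻ z, ‖a (z - ζ • v)‖ₑ ^ 2 ∂μ ∂ν := by
        rw [lintegral_const_mul _ hpair.lintegral_prod_right', lintegral_lintegral_swap hpair.aemeasurable]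
    _ = ν univ * ∫⁻ _ζ, ∫⁻ z, ‖a z‖ₑ ^ 2 ∂μ ∂ν := by
        congr 1
        refine lintegral_congr fun ζ => ?_
        exact lintegral_sub_right_eq_self (fun z => ‖a z‖ₑ ^ 2) (ζ • v)
    _ = (∫⁻ ζ in B, ‖ζ⁻¹‖ₑ) ^ 2 * ∫⁻ z, ‖a z‖ₑ ^ 2 ∂μ := by
        rw [lintegral_const, hν]; ring

end SeveralVariables

/-- A smooth cutoff function with bounded derivative, equal to `1` near `E` and supported near
`E`. -/
theorem exists_smooth_cutoff {X : Type*} [NormedAddCommGroup X] [NormedSpace ℝ X]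
    [FiniteDimensional ℝ X] (E : Set X) {δ : ℝ} (hδ : 0 < δ) :
    ∃ ψ : X → ℝ, ContDiff ℝ 2 ψ ∧ (∀ z ∈ Metric.thickening δ E, ψ z = 1) ∧
      (∀ z ∉ Metric.thickening (3 * δ) E, ψ z = 0) ∧ ∃ C, ∀ z, ‖fderiv ℝ ψ z‖ ≤ C := by
  borelize X
  let μ : Measure X := Measure.addHaar
  let φ : ContDiffBump (0 : X) := ⟨δ / 2, δ, half_pos hδ, half_lt_self hδ⟩
  let g : X → ℝ := (Metric.thickening (2 * δ) E).indicator 1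
  have hgm : Measurable g := measurable_one.indicator Metric.isOpen_thickening.measurableSet
  have hg1 : ∀ z, ‖g z‖ ≤ 1 := fun z => by
    refine (norm_indicator_le_norm_self _ _).trans (by simp)
  have hgi : LocallyIntegrable g μ := by
    refine (locallyIntegrable_const (1 : ℝ)).mono hgm.aestronglyMeasurable
      (Eventually.of_forall fun z => ?_)
    simpa using hg1 z
  have hφ : HasCompactSupport (φ.normed μ) := φ.hasCompactSupport_normed
  have hφ2 : ContDiff ℝ (2 : ℕ∞) (φ.normed μ) := φ.contDiff_normed
  have hφ1 : ContDiff ℝ 1 (φ.normed μ) := φ.contDiff_normed (n := 1)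
  refine ⟨convolution (φ.normed μ) g (ContinuousLinearMap.lsmul ℝ ℝ) μ,
    hφ.contDiff_convolution_left _ hφ2 hgi, fun z hz => ?_, fun z hz => ?_, ?_⟩
  · have hball : ∀ x ∈ Metric.ball z δ, g x = 1 := by
      intro x hx
      refine indicator_of_mem ?_ _
      obtain ⟨y, hy, hzy⟩ := Metric.mem_thickening_iff.1 hz
      refine Metric.mem_thickening_iff.2 ⟨y, hy, ?_⟩
      have := dist_triangle x z y
      rw [Metric.mem_ball] at hx; linarith
    have hzz := hball z (Metric.mem_ball_self hδ)
    rw [ContDiffBump.normed_convolution_eq_right, hzz]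
    intro x hx
    rw [hzz, hball x hx]
  · have hball : ∀ x ∈ Metric.ball z δ, g x = 0 := by
      intro x hx
      refine indicator_of_notMem (fun h => hz ?_) _
      obtain ⟨y, hy, hxy⟩ := Metric.mem_thickening_iff.1 h
      refine Metric.mem_thickening_iff.2 ⟨y, hy, ?_⟩
      have := dist_triangle_left z y x
      rw [Metric.mem_ball] at hx; linarith
    have hzz := hball z (Metric.mem_ball_self hδ)
    rw [ContDiffBump.normed_convolution_eq_right, hzz]
    intro x hx
    rw [hzz, hball x hx]
  · have hcont : Continuous (fderiv ℝ (φ.normed μ)) := hφ1.continuous_fderiv one_ne_zero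
    have hint : Integrable (fun t => ‖fderiv ℝ (φ.normed μ) t‖) μ :=
      (hcont.integrable_of_hasCompactSupport (hφ.fderiv ℝ)).norm
    refine ⟨∫ t, ‖fderiv ℝ (φ.normed μ) t‖ ∂μ, fun z => ?_⟩
    rw [(hφ.hasFDerivAt_convolution_left _ hφ1 hgi z).fderiv]
    refine norm_integral_le_of_norm_le hint (Eventually.of_forall fun t => ?_)
    refine ContinuousLinearMap.opNorm_le_bound _ (norm_nonneg _) fun x => ?_
    rw [ContinuousLinearMap.precompL_apply, ContinuousLinearMap.lsmul_apply, norm_smul]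
    calc ‖fderiv ℝ (φ.normed μ) t x‖ * ‖g (z - t)‖ ≤ ‖fderiv ℝ (φ.normed μ) t x‖ :=
          mul_le_of_le_one_right (norm_nonneg _) (hg1 _)
      _ ≤ ‖fderiv ℝ (φ.normed μ) t‖ * ‖x‖ := ContinuousLinearMap.le_opNorm _ _

section TransverseDirection

variable {X : Type*} [NormedAddCommGroup X] [NormedSpace ℂ X] [FiniteDimensional ℂ X]

/-- A real subspace of real codimension at least two meets some complex line only in the
origin. -/
theorem exists_forall_smul_mem_imp_eq_zero {V : Submodule ℝ X}
    (hV : 2 ≤ Module.finrank ℝ (X ⧸ V)) : ∃ v : X, ∀ ζ : ℂ, ζ • v ∈ V → ζ = 0 := by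
  have : FiniteDimensional ℝ X := FiniteDimensional.complexToReal X
  let Φ : ℝ × V → X := fun p => Complex.exp (p.1 * Complex.I) • (p.2 : X)
  have hΦ : ContDiff ℝ 1 Φ := by
    have h1 : ContDiff ℝ 1 fun p : ℝ × V => Complex.exp (p.1 * Complex.I) :=
      ((Complex.ofRealCLM.contDiff.comp contDiff_fst).mul contDiff_const).cexp
    have h2 : ContDiff ℝ 1 fun p : ℝ × V => (p.2 : X) := V.subtypeL.contDiff.comp contDiff_snd
    exact h1.smul h2
  have hdim : Module.finrank ℝ (ℝ × V) < Module.finrank ℝ X := by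
    rw [Module.finrank_prod, Module.finrank_self, ← V.finrank_quotient_add_finrank]
    omega
  obtain ⟨v, hv⟩ := (hΦ.dense_compl_range_of_finrank_lt_finrank hdim).nonempty
  refine ⟨v, fun ζ hζ => by_contra fun h0 => hv ?_⟩
  have hn : (‖ζ‖ : ℂ) ≠ 0 := by simpa using h0
  refine ⟨(-ζ.arg, ⟨(‖ζ‖⁻¹ : ℝ) • ζ • v, V.smul_mem _ hζ⟩), ?_⟩
  simp only [Φ]
  have h1 : Complex.exp ((-ζ.arg : ℝ) * Complex.I) * ((‖ζ‖⁻¹ : ℝ) : ℂ) * ζ = 1 := by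
    calc _ = Complex.exp ((-ζ.arg : ℝ) * Complex.I) * (((‖ζ‖⁻¹ : ℝ) : ℂ) *
          (‖ζ‖ * Complex.exp (ζ.arg * Complex.I))) := by
          rw [Complex.norm_mul_exp_arg_mul_I, mul_assoc]
      _ = 1 := by
          rw [Complex.ofReal_inv, inv_mul_cancel_left₀ hn, ← Complex.exp_add]
          simp
  rw [← Complex.coe_smul, smul_smul, smul_smul, h1, one_smul]

/-- A real linear projection onto the complex line spanned by `v` that vanishes on `V`. -/
theorem exists_continuousLinearMap_smul_eq {V : Submodule ℝ X} {v : X}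
    (hv : ∀ ζ : ℂ, ζ • v ∈ V → ζ = 0) :
    ∃ L : X →L[ℝ] ℂ, (∀ ζ : ℂ, L (ζ • v) = ζ) ∧ ∀ x ∈ V, L x = 0 := by
  have : FiniteDimensional ℝ X := FiniteDimensional.complexToReal X
  let ι : ℂ →ₗ[ℝ] X ⧸ V := V.mkQ ∘ₗ (LinearMap.toSpanSingleton ℂ X v).restrictScalars ℝ
  have hι : LinearMap.ker ι = ⊥ := by
    rw [LinearMap.ker_eq_bot']
    intro ζ hζ
    exact hv ζ ((Submodule.Quotient.mk_eq_zero V).1 hζ)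
  obtain ⟨g, hg⟩ := ι.exists_leftInverse_of_injective hι
  refine ⟨LinearMap.toContinuousLinearMap (g ∘ₗ V.mkQ), fun ζ => LinearMap.congr_fun hg ζ,
    fun x hx => ?_⟩
  have : V.mkQ x = 0 := (Submodule.Quotient.mk_eq_zero V).2 hx
  simp [this]

/-- If `V` has real codimension at least three, then some nonzero real functional vanishes on `V`
and on the complex line spanned by `v`. -/
theorem exists_functional_vanishing {V : Submodule ℝ X} (hV : 3 ≤ Module.finrank ℝ (X ⧸ V))
    (v : X) : ∃ (ℓ : X →L[ℝ] ℝ) (w : X), ℓ w = 1 ∧ (∀ x ∈ V, ℓ x = 0) ∧ ∀ ζ : ℂ, ℓ (ζ • v) = 0 := by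
  have : FiniteDimensional ℝ X := FiniteDimensional.complexToReal X
  let ι : ℂ →ₗ[ℝ] X := (LinearMap.toSpanSingleton ℂ X v).restrictScalars ℝ
  have hlt : V ⊔ LinearMap.range ι < ⊤ := by
    refine Submodule.lt_top_of_finrank_lt_finrank ?_
    have h1 := Submodule.finrank_add_le_finrank_add_finrank V (LinearMap.range ι)
    have h2 := LinearMap.finrank_range_le ι
    rw [Complex.finrank_real_complex] at h2
    have h3 := V.finrank_quotient_add_finrank
    omega
  obtain ⟨ℓ, hℓ, hker⟩ := Submodule.exists_le_ker_of_lt_top _ hlt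
  obtain ⟨w, hw⟩ : ∃ w, ℓ w ≠ 0 := by
    by_contra! h
    exact hℓ (LinearMap.ext h)
  refine ⟨LinearMap.toContinuousLinearMap ℓ, (ℓ w)⁻¹ • w, ?_, fun x hx => ?_, fun ζ => ?_⟩
  · simp [hw]
  · exact hker (Submodule.mem_sup_left hx)
  · exact hker (Submodule.mem_sup_right ⟨ζ, rfl⟩)

end TransverseDirection

section Extension

variable {X : Type*} [NormedAddCommGroup X] [NormedSpace ℂ X] [FiniteDimensional ℂ X]
  [MeasurableSpace X] [BorelSpace X]

/-- A holomorphic function on `Ω \ E`, where `E` lies in a tube around a real affine subspace of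
codimension at least three and at positive distance from the complement of `Ω`, extends
to `Ω`, and the extension is square integrable on `E` if the function is so on `Ω \ E`. -/
theorem exists_holomorphic_extension (μ : Measure X) [μ.IsAddHaarMeasure] {Ω E : Set X}
    (hΩ : IsOpen Ω) (hE : IsClosed E) (hEne : E.Nonempty) (hc : IsPreconnected (Ω \ E))
    {r : ℝ} (hr : 0 < r) (hEr : Metric.cthickening r E ⊆ Ω) {V : Submodule ℝ X}
    (hV : 3 ≤ Module.finrank ℝ (X ⧸ V)) {h₀ : X} {R : ℝ}
    (hR : ∀ z ∈ E, ∃ x ∈ V, ‖z - (h₀ + x)‖ < R) {f : X → ℂ} (hf : DifferentiableOn ℂ f (Ω \ E)) :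
    ∃ F : X → ℂ, DifferentiableOn ℂ F Ω ∧ EqOn F f (Ω \ E) ∧
      (∫⁻ z in Ω \ E, ‖f z‖ₑ ^ 2 ∂μ < ⊤ → ∫⁻ z in E, ‖F z‖ₑ ^ 2 ∂μ < ⊤) := by
  have : FiniteDimensional ℝ X := FiniteDimensional.complexToReal X
  have hU : IsOpen (Ω \ E) := hΩ.sdiff hE
  obtain ⟨v, hv⟩ := exists_forall_smul_mem_imp_eq_zero (hV.trans' (by norm_num))
  obtain ⟨L, hL, hLV⟩ := exists_continuousLinearMap_smul_eq hv
  obtain ⟨ℓ, w₀, hw₀, hℓV, hℓv⟩ := exists_functional_vanishing hV v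
  obtain ⟨δ, hδ, hδr⟩ : ∃ δ, 0 < δ ∧ 3 * δ < r := ⟨r / 6, by positivity, by linarith⟩
  obtain ⟨ψ, hψ2, hψ1, hψ0, D, hD⟩ := exists_smooth_cutoff E hδ
  set K := Metric.cthickening (3 * δ) E
  have hK : IsClosed K := Metric.isClosed_cthickening
  have hEK : E ⊆ K := Metric.self_subset_cthickening E
  have hKΩ : K ⊆ Ω := (Metric.cthickening_mono hδr.le E).trans hEr
  have hKV : ∀ z ∈ K, ∃ x ∈ V, ‖z - (h₀ + x)‖ ≤ R + r := by
    intro z hz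
    obtain ⟨e, he, hze⟩ := Metric.mem_thickening_iff.1
      (Metric.cthickening_subset_thickening' hr hδr E hz)
    obtain ⟨x, hx, hxe⟩ := hR e he
    refine ⟨x, hx, ?_⟩
    rw [dist_eq_norm] at hze
    have := norm_add_le (z - e) (e - (h₀ + x))
    rw [sub_add_sub_cancel] at this
    linarith
  -- the cutoff function and its `∂̄`-derivatives
  let χ : X → ℂ := fun z => ψ z
  have hχ : ContDiff ℝ 2 χ := Complex.ofRealCLM.contDiff.comp hψ2
  have hχd : Differentiable ℝ χ := hχ.differentiable two_ne_zero
  have hχE : ∀ z ∈ E, χ =ᶠ[𝓝 z] fun _ => 1 := fun z hz => by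
    filter_upwards [Metric.isOpen_thickening.mem_nhds (Metric.self_subset_thickening hδ E hz)]
      with y hy
    simp [χ, hψ1 y hy]
  have hχK : ∀ z ∉ K, χ =ᶠ[𝓝 z] fun _ => 0 := fun z hz => by
    filter_upwards [hK.isOpen_compl.mem_nhds hz] with y hy
    simp [χ, hψ0 y fun h => hy (Metric.thickening_subset_cthickening _ _ h)]
  have hb : ∀ w, ContDiff ℝ 1 (dbar w χ) := fun w => contDiff_dbar hχ (by norm_num) w
  have hbd : ∀ w, Differentiable ℝ (dbar w χ) := fun w => (hb w).differentiable one_ne_zero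
  have hbz : ∀ z, z ∉ Ω \ E → ∀ w, dbar w χ =ᶠ[𝓝 z] fun _ => 0 := by
    intro z hz w
    by_cases hzE : z ∈ E
    · filter_upwards [(hχE z hzE).eventuallyEq_nhds] with y hy
      rw [dbar_congr hy, dbar_const]
    · have hzK : z ∉ K := fun h => hz ⟨hKΩ h, hzE⟩
      filter_upwards [(hχK z hzK).eventuallyEq_nhds] with y hy
      rw [dbar_congr hy, dbar_const]
  have hbK : ∀ w z, dbar w χ z ≠ 0 → z ∈ K := by
    intro w z h
    by_contra hz
    exact h (by rw [dbar_congr (hχK z hz), dbar_const])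
  -- the data of the Cauchy–Riemann equations
  let a : X → X → ℂ := fun w z => f z * dbar w χ z
  have haz : ∀ z, z ∉ Ω \ E → ∀ w, a w =ᶠ[𝓝 z] fun _ => 0 := by
    intro z hz w
    filter_upwards [hbz z hz w] with y hy
    simp [a, hy]
  have hfd : ∀ z ∈ Ω \ E, DifferentiableAt ℂ f z := fun z hz => hf.differentiableAt (hU.mem_nhds hz)
  have hfdR : ∀ z ∈ Ω \ E, DifferentiableAt ℝ f z := fun z hz => (hfd z hz).restrictScalars ℝ
  have had : ∀ w, Differentiable ℝ (a w) := by
    intro w z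
    by_cases hz : z ∈ Ω \ E
    · exact (hfdR z hz).mul (hbd w z)
    · exact (haz z hz w).differentiableAt_iff.2 (differentiableAt_const _)
  have habd : ∀ w K', IsCompact K' → ∃ C, ∀ z ∈ K', ‖fderiv ℝ (a w) z‖ ≤ C := by
    intro w
    refine exists_bound_of_locally_bounded fun z => ?_
    by_cases hz : z ∈ Ω \ E
    · obtain ⟨C₁, hC₁⟩ := exists_eventually_norm_fderiv_le hU hf hz
      obtain ⟨C₂, hC₂⟩ : ∃ C, ∀ᶠ y in 𝓝 z, ‖f y‖ ≤ C :=
        ⟨‖f z‖ + 1, ((hfd z hz).continuousAt.norm.eventually_lt_const (lt_add_one _)).mono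
          fun _ h => h.le⟩
      obtain ⟨C₃, hC₃⟩ : ∃ C, ∀ᶠ y in 𝓝 z, ‖dbar w χ y‖ ≤ C :=
        ⟨‖dbar w χ z‖ + 1, ((hbd w).continuous.continuousAt.norm.eventually_lt_const
          (lt_add_one _)).mono fun _ h => h.le⟩
      obtain ⟨C₄, hC₄⟩ : ∃ C, ∀ᶠ y in 𝓝 z, ‖fderiv ℝ (dbar w χ) y‖ ≤ C :=
        ⟨‖fderiv ℝ (dbar w χ) z‖ + 1, (((hb w).continuous_fderiv
          one_ne_zero).continuousAt.norm.eventually_lt_const (lt_add_one _)).mono fun _ h => h.le⟩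
      refine ⟨C₂ * C₄ + C₃ * C₁, ?_⟩
      filter_upwards [hC₁, hC₂, hC₃, hC₄, hU.mem_nhds hz] with y h₁ h₂ h₃ h₄ hy
      have : fderiv ℝ (a w) y = _ := fderiv_fun_mul (hfdR y hy) (hbd w y)
      rw [this]
      refine (norm_add_le _ _).trans ?_
      rw [norm_smul, norm_smul]
      have := (norm_nonneg _).trans h₂
      have := (norm_nonneg _).trans h₃
      gcongr
    · refine ⟨0, ?_⟩
      filter_upwards [(haz z hz w).eventuallyEq_nhds] with y hy
      rw [hy.fderiv_eq]; simp
  have haK : ∀ w z, a w z ≠ 0 → z ∈ K := fun w z h => hbK w z (right_ne_zero_of_mul h)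
  set M : ℝ := ‖L h₀‖ + ‖L‖ * (R + r)
  have hKM : ∀ z ∈ K, ‖L z‖ ≤ M := by
    intro z hz
    obtain ⟨x, hx, hzx⟩ := hKV z hz
    have h1 : L z = L h₀ + L (z - (h₀ + x)) := by
      rw [map_sub, map_add, hLV x hx]; ring
    rw [h1]
    exact (norm_add_le _ _).trans (add_le_add le_rfl (L.le_opNorm_of_le hzx))
  have haM : ∀ w z, a w z ≠ 0 → ‖L z‖ ≤ M := fun w z h => hKM z (haK w z h)
  have hacomm : ∀ w z, dbar w (a v) z = dbar v (a w) z := by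
    intro w z
    by_cases hz : z ∈ Ω \ E
    · rw [dbar_mul (hfdR z hz) (hbd v z), dbar_mul (hfdR z hz) (hbd w z),
        dbar_eq_zero (hfd z hz), dbar_eq_zero (hfd z hz), dbar_comm hχ]
      ring
    · rw [dbar_congr (haz z hz v), dbar_congr (haz z hz w), dbar_const, dbar_const]
  -- the solution
  let u : X → ℂ := fun z => (2 * Real.pi : ℂ)⁻¹ * cauchyTransform v (a v) z
  have hpi : (2 * Real.pi : ℂ) ≠ 0 := by
    exact_mod_cast mul_ne_zero two_ne_zero Real.pi_ne_zero
  have hCd : Differentiable ℝ (cauchyTransform v (a v)) := fun z =>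
    (hasFDerivAt_cauchyTransform hL (had v) (habd v) (haM v) z).1.differentiableAt
  have hud : Differentiable ℝ u := hCd.const_mul _
  have hu : ∀ w z, dbar w u z = a w z := by
    intro w z
    rw [dbar_mul (differentiableAt_const _) (hCd z), dbar_const,
      dbar_cauchyTransform hL (had v) (habd v) (haM v), funext (hacomm w),
      cauchyTransform_dbar hL (had w) (habd w) (haM w), mul_zero, add_zero,
      inv_mul_cancel_left₀ hpi]
  let F : X → ℂ := fun z => (1 - χ z) * f z + u z
  have hFE : ∀ z ∈ E, F =ᶠ[𝓝 z] u := fun z hz => by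
    filter_upwards [hχE z hz] with y hy
    simp [F, hy]
  have hF : DifferentiableOn ℂ F Ω := by
    intro z hz
    refine DifferentiableAt.differentiableWithinAt ?_
    by_cases hzE : z ∈ E
    · refine (hFE z hzE).differentiableAt_iff.2 (differentiableAt_of_dbar_eq_zero (hud z) fun w => ?_)
      rw [hu, (haz z (fun h => h.2 hzE) w).eq_of_nhds]
    · have hzU : z ∈ Ω \ E := ⟨hz, hzE⟩
      have h1 : DifferentiableAt ℝ (fun z => 1 - χ z) z := (hχd z).const_sub 1
      have h2 : DifferentiableAt ℝ (fun z => (1 - χ z) * f z) z := h1.mul (hfdR z hzU)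
      refine differentiableAt_of_dbar_eq_zero (h2.add (hud z)) fun w => ?_
      have h3 : dbar w (fun z => 1 - χ z) z = - dbar w χ z := by
        simp only [dbar, fderiv_const_sub, neg_apply]; ring
      rw [dbar_add h2 (hud z), dbar_mul h1 (hfdR z hzU), dbar_eq_zero (hfd z hzU), hu, h3]
      ring
  refine ⟨F, hF, ?_, fun hfin => ?_⟩
  · -- the solution vanishes on a half space, hence on the component of `Kᶜ` which meets it
    have hsep : ∀ z ∈ K, ℓ (z - h₀) ≤ ‖ℓ‖ * (R + r) := by
      intro z hz
      obtain ⟨x, hx, hzx⟩ := hKV z hz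
      have h1 : ℓ (z - h₀) = ℓ (z - (h₀ + x)) := by
        rw [← sub_sub, map_sub _ _ x, hℓV x hx, sub_zero]
      rw [h1]
      exact (le_abs_self _).trans (ℓ.le_opNorm_of_le hzx)
    let W : Set X := {z | ‖ℓ‖ * (R + r) < ℓ (z - h₀)}
    have hW : IsOpen W := isOpen_lt continuous_const (by fun_prop)
    have huW : ∀ z ∈ W, u z = 0 := by
      intro z hz
      have : ∀ ζ : ℂ, a v (z - ζ • v) = 0 := by
        intro ζ
        by_contra h
        have h1 := hsep _ (haK v _ h)
        rw [sub_right_comm, map_sub, hℓv, sub_zero] at h1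
        exact absurd h1 (not_le.2 hz)
      simp [u, cauchyTransform, this]
    let p : X := h₀ + (‖ℓ‖ * (R + r) + 1) • w₀
    have hpW : p ∈ W := by
      simp [W, p, hw₀]
    have hpK : p ∈ Kᶜ := fun h => absurd (hsep p h) (not_le.2 hpW)
    set C₀ := connectedComponentIn Kᶜ p
    have hC₀ : IsOpen C₀ := hK.isOpen_compl.connectedComponentIn
    have hC₀K : C₀ ⊆ Kᶜ := connectedComponentIn_subset _ _
    have hpC₀ : p ∈ C₀ := mem_connectedComponentIn hpK
    have huK : DifferentiableOn ℂ u Kᶜ := fun z hz =>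
      (differentiableAt_of_dbar_eq_zero (hud z) fun w => by
        rw [hu]; by_contra h; exact hz (haK w z h)).differentiableWithinAt
    have huC : EqOn u (fun _ => 0) C₀ :=
      eqOn_of_isPreconnected_of_eventuallyEq hC₀ isPreconnected_connectedComponentIn
        (huK.mono hC₀K) (differentiableOn_const 0) hpC₀
        (mem_of_superset (hW.mem_nhds hpW) fun z hz => huW z hz)
    obtain ⟨q, hq⟩ : (frontier C₀).Nonempty := by
      refine nonempty_frontier_iff.2 ⟨⟨p, hpC₀⟩, fun h => ?_⟩
      obtain ⟨e, he⟩ := hEne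
      exact hC₀K (h ▸ mem_univ e) (hEK he)
    have hqK : q ∈ K := by
      by_contra h
      have h1 : q ∈ connectedComponentIn Kᶜ q := mem_connectedComponentIn h
      obtain ⟨y, hyq, hy⟩ := mem_closure_iff_nhds.1 (frontier_subset_closure hq) _
        (hK.isOpen_compl.connectedComponentIn.mem_nhds h1)
      have h2 : q ∈ C₀ := by
        rw [show C₀ = _ from connectedComponentIn_eq hy, ← connectedComponentIn_eq hyq]
        exact h1
      rw [hC₀.frontier_eq] at hq
      exact hq.2 h2
    obtain ⟨y, hyΩ, hy⟩ := mem_closure_iff_nhds.1 (frontier_subset_closure hq) _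
      (hΩ.mem_nhds (hKΩ hqK))
    have hyU : y ∈ Ω \ E := ⟨hyΩ, fun h => hC₀K hy (hEK h)⟩
    refine eqOn_of_isPreconnected_of_eventuallyEq hU hc (hF.mono sdiff_subset) hf hyU ?_
    filter_upwards [hC₀.mem_nhds hy] with z hz
    simp [F, huC hz, (hχK z (hC₀K hz)).eq_of_nhds]
  · have hEm := hE.measurableSet
    have haL : ∫⁻ z, ‖a v z‖ₑ ^ 2 ∂μ < ⊤ := by
      let A : ENNReal := ENNReal.ofReal (2 * ‖v‖ * D) ^ 2
      have hle : ∀ z, ‖a v z‖ₑ ^ 2 ≤ (Ω \ E).indicator (fun z => A * ‖f z‖ₑ ^ 2) z := by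
        intro z
        by_cases hz : z ∈ Ω \ E
        · rw [indicator_of_mem hz, enorm_mul, mul_pow, mul_comm]
          refine mul_le_mul' (pow_le_pow_left' ?_ 2) le_rfl
          rw [← ofReal_norm]
          refine ENNReal.ofReal_le_ofReal ((norm_dbar_le v χ z).trans ?_)
          have h1 : fderiv ℝ χ z = Complex.ofRealCLM.comp (fderiv ℝ ψ z) :=
            (Complex.ofRealCLM.hasFDerivAt.comp z
              ((hψ2.differentiable two_ne_zero) z).hasFDerivAt).fderiv
          rw [h1]
          gcongr
          refine (ContinuousLinearMap.opNorm_comp_le _ _).trans ?_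
          rw [Complex.ofRealCLM_norm, one_mul]
          exact hD z
        · rw [(haz z hz v).eq_of_nhds]; simp
      refine (lintegral_mono hle).trans_lt ?_
      have hA : A < ⊤ := ENNReal.pow_lt_top ENNReal.ofReal_lt_top
      rw [lintegral_indicator hU.measurableSet, lintegral_const_mul' _ _ hA.ne]
      exact ENNReal.mul_lt_top hA hfin
    have hmain := lintegral_sq_cauchyTransform_le μ v (had v).continuous hEm (ρ := M + M)
      fun z hz ζ h => (norm_le_of_strip hL (haM v _ h)).trans
        (by gcongr; exact hKM z (hEK hz))
    have hFu : ∀ z ∈ E, ‖F z‖ₑ ^ 2 =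
        ‖(2 * Real.pi : ℂ)⁻¹‖ₑ ^ 2 * ‖cauchyTransform v (a v) z‖ₑ ^ 2 := by
      intro z hz
      rw [(hFE z hz).eq_of_nhds, enorm_mul, mul_pow]
    have hc2 : ‖(2 * Real.pi : ℂ)⁻¹‖ₑ ^ 2 < ⊤ := ENNReal.pow_lt_top enorm_lt_top
    rw [setLIntegral_congr_fun hEm hFu, lintegral_const_mul' _ _ hc2.ne]
    refine ENNReal.mul_lt_top hc2 (hmain.trans_lt (ENNReal.mul_lt_top ?_ haL))
    exact ENNReal.pow_lt_top (lintegral_enorm_inv_closedBall_lt_top _)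

end Extension

theorem memLp_two_iff_lintegral_sq {Y : Type*} [MeasurableSpace Y] {μ : Measure Y} {f : Y → ℂ} :
    MemLp f 2 μ ↔ AEStronglyMeasurable f μ ∧ ∫⁻ z, ‖f z‖ₑ ^ 2 ∂μ < ⊤ := by
  rw [MemLp, eLpNorm_lt_top_iff_lintegral_rpow_enorm_lt_top two_ne_zero ENNReal.ofNat_ne_top]
  simp

theorem IsL2Holomorphic.mono {n : ℕ} {U U' : Set (CSpace n)} {F : CSpace n → ℂ}
    (hF : IsL2Holomorphic U F) (h : U' ⊆ U) : IsL2Holomorphic U' F :=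
  ⟨hF.1.mono h, hF.2.mono_measure (Measure.restrict_mono h le_rfl)⟩

theorem exists_isL2Holomorphic_extension {n : ℕ} {Ω E : Set (CSpace n)}
    (hΩ : IsOpen Ω) (hE : IsClosed E) (h1 : ∃ r : ℝ, 0 < r ∧ Metric.cthickening r E ⊆ Ω)
    (h2 : ∃ (H : AffineSubspace ℝ (CSpace n)) (R : ℝ),
      (H : Set (CSpace n)).Nonempty ∧
      3 ≤ Module.finrank ℝ (CSpace n ⧸ H.direction) ∧
      0 < R ∧ E ⊆ Metric.thickening R (H : Set (CSpace n)))
    (h3 : IsPreconnected (Ω \ E)) {f : CSpace n → ℂ} (hf : IsL2Holomorphic (Ω \ E) f) :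
    ∃ F : CSpace n → ℂ, IsL2Holomorphic Ω F ∧ EqOn F f (Ω \ E) := by
  rcases E.eq_empty_or_nonempty with rfl | hEne
  · rw [sdiff_empty] at hf
    exact ⟨f, hf, fun _ _ => rfl⟩
  obtain ⟨r, hr, hEr⟩ := h1
  obtain ⟨H, R, ⟨h₀, hh₀⟩, hcodim, -, hEH⟩ := h2
  have hR : ∀ z ∈ E, ∃ x ∈ H.direction, ‖z - (h₀ + x)‖ < R := by
    intro z hz
    obtain ⟨h, hh, hzh⟩ := Metric.mem_thickening_iff.1 (hEH hz)
    refine ⟨h - h₀, AffineSubspace.vsub_mem_direction hh hh₀, ?_⟩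
    rwa [add_sub_cancel, ← dist_eq_norm]
  obtain ⟨F, hF, hFf, hFE⟩ := exists_holomorphic_extension (volume : Measure (CSpace n)) hΩ hE hEne
    h3 hr hEr hcodim hR hf.1
  have hEΩ : E ⊆ Ω := (Metric.self_subset_cthickening E).trans hEr
  refine ⟨F, ⟨hF, memLp_two_iff_lintegral_sq.2
    ⟨hF.continuousOn.aestronglyMeasurable hΩ.measurableSet, ?_⟩⟩, hFf⟩
  have hfin := (memLp_two_iff_lintegral_sq.1 hf.2).2
  have hUm : MeasurableSet (Ω \ E) := (hΩ.sdiff hE).measurableSet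
  rw [← sdiff_union_of_subset hEΩ]
  refine (lintegral_union_le _ _ _).trans_lt (ENNReal.add_lt_top.2 ⟨?_, hFE hfin⟩)
  rwa [setLIntegral_congr_fun hUm fun z hz => by rw [hFf hz]]

theorem theorem1p1 (n : ℕ) (hn : 2 ≤ n) (Ω E : Set (CSpace n))
    (hΩ_open : IsOpen Ω) (hΩ_conn : IsConnected Ω) (hE_closed : IsClosed E)
    (h1 : ∃ r : ℝ, 0 < r ∧ Metric.cthickening r E ⊆ Ω)
    (h2 : ∃ (H : AffineSubspace ℝ (CSpace n)) (R : ℝ),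
      (H : Set (CSpace n)).Nonempty ∧
      3 ≤ Module.finrank ℝ (CSpace n ⧸ H.direction) ∧
      0 < R ∧ E ⊆ Metric.thickening R (H : Set (CSpace n)))
    (h3 : IsConnected (Ω \ E)) :
    (∀ f : CSpace n → ℂ, IsL2Holomorphic (Ω \ E) f →
      ∃ F : CSpace n → ℂ, IsL2Holomorphic Ω F ∧ Set.EqOn F f (Ω \ E)) ∧
    Set.BijOn (restrictToDiff Ω E) (bergmanSpace Ω) (bergmanSpace (Ω \ E)) := by
  have hext := fun f (hf : IsL2Holomorphic (Ω \ E) f) =>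
    exists_isL2Holomorphic_extension hΩ_open hE_closed h1 h2 h3.isPreconnected hf
  refine ⟨hext, ?_, ?_, ?_⟩
  · rintro _ ⟨F, hF, rfl⟩
    exact ⟨F, hF.mono sdiff_subset, rfl⟩
  · rintro _ ⟨F, hF, rfl⟩ _ ⟨G, hG, rfl⟩ hFG
    obtain ⟨z, hz⟩ := h3.nonempty
    have hnear : F =ᶠ[𝓝 z] G := by
      filter_upwards [(hΩ_open.sdiff hE_closed).mem_nhds hz] with y hy
      exact congrFun hFG ⟨y, hy⟩
    exact funext fun y => eqOn_of_isPreconnected_of_eventuallyEq hΩ_open hΩ_conn.isPreconnected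
      hF.1 hG.1 hz.1 hnear y.2
  · rintro _ ⟨f, hf, rfl⟩
    obtain ⟨F, hF, hFf⟩ := hext f hf
    exact ⟨fun z => F z, ⟨F, hF, rfl⟩, funext fun z => hFf z.2⟩
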